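/- **Theorem 2.1.** Let $X$ be a numerical radius operator space, that is, a complex vector space together with a norm $\mathcal W_n$ on the space $\mathbb M_n(X)$ of $n\times n$ matrices over $X$ for each $n\in\mathbb N$, such that for all $m,n\in\mathbb N$, $x\in\mathbb M_m(X)$, $y\in\mathbb M_n(X)$ and $\alpha\in\mathbb M_{n,m}(\mathbb C)$, $$\text{(WI)}\quad \mathcal W_{m+n}\left(\begin{bmatrix}x&0\\0&y\end{bmatrix}\right)=\max\{\mathcal W_m(x),\mathcal W_n(y)\},\qquad \text{(WII)}\quad \mathcal W_n(\alpha x\alpha^*)\le\|\alpha\|^2\,\mathcal W_m(x),$$ where $\|\alpha\|$ is the operator norm of $\alpha:\mathbb C^m\to\mathbb C^n$ for the Euclidean norms. Then there exist a complex Hilbert space $\mathcal H$, a linear subspace $Y\subset\mathbb B(\mathcal H)$ and a linear map $\Phi$ from $X$ onto $Y$ such that $$w_n([\Phi(x_{ij})])=\mathcal W_n([x_{ij}])\qquad\text{for all } [x_{ij}]\in\mathbb M_n(X),\ n\in\mathbb N.$$ Here $\mathbb M_n(\mathbb B(\mathcal H))$ is identified with $\mathbb B(\mathcal H^n)$, where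 $\mathcal H^n$ is the $n$-fold Hilbert space direct sum of $\mathcal H$, and $w_n(a)=\sup\{|(a\xi\,|\,\xi)| : \xi\in\mathcal H^n,\ \|\xi\|=1\}$ is the numerical radius of $a\in\mathbb B(\mathcal H^n)$ (equal to $0$ if $\mathcal H=0$). In other words, $\Phi$ is a $\mathcal W$-complete isometry from $(X,\mathcal W_n)$ onto the concrete numerical radius operator space $(Y,w_n)$. -/

import Mathlib

universe u

section

open scoped InnerProductSpace Matrix.Norms.L2Operator

/-- The numerical radius `w(a) = sup {|(a ξ | ξ)| : ‖ξ‖ = 1}` of a bounded operator `a`.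
The set is bounded above by `‖a‖`; on the zero space the supremum is `0`. -/
noncomputable def numericalRadius {K : Type*} [NormedAddCommGroup K] [InnerProductSpace ℂ K]
    (a : K →L[ℂ] K) : ℝ :=
  sSup {r : ℝ | ∃ ξ : K, ‖ξ‖ = 1 ∧ r = ‖⟪a ξ, ξ⟫_ℂ‖}

/-- The identification of `M_n(B(H))` with `B(H^n)`, where `H^n` is the Hilbert space direct sum:
`(a ξ)_i = ∑ j, a_ij ξ_j`. -/
noncomputable def matrixOperator {H : Type*} [NormedAddCommGroup H] [InnerProductSpace ℂ H]
    {n : ℕ} (a : Matrix (Fin n) (Fin n) (H →L[ℂ] H)) :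
    PiLp 2 (fun _ : Fin n => H) →L[ℂ] PiLp 2 (fun _ : Fin n => H) :=
  ((PiLp.continuousLinearEquiv 2 ℂ (fun _ : Fin n => H)).symm :
      (Fin n → H) →L[ℂ] PiLp 2 (fun _ : Fin n => H)) ∘L
    ContinuousLinearMap.pi (fun i => ∑ j, a i j ∘L PiLp.proj 2 (fun _ : Fin n => H) j)

/-- The direct sum `x ⊕ y ∈ M_{m+n}(X)` of `x ∈ M_m(X)` and `y ∈ M_n(X)`, i.e. the block diagonal
matrix with blocks `x` and `y`. -/
def matrixDirectSum {X : Type*} [AddCommGroup X] {m n : ℕ}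
    (x : Matrix (Fin m) (Fin m) X) (y : Matrix (Fin n) (Fin n) X) :
    Matrix (Fin (m + n)) (Fin (m + n)) X :=
  Matrix.reindex finSumFinEquiv finSumFinEquiv (Matrix.fromBlocks x 0 0 y)

/-- The product `α x α^* ∈ M_n(X)` for `α ∈ M_{n,m}(ℂ)` and `x ∈ M_m(X)`. -/
noncomputable def matrixConj {X : Type*} [AddCommGroup X] [Module ℂ X] {m n : ℕ}
    (α : Matrix (Fin n) (Fin m) ℂ) (x : Matrix (Fin m) (Fin m) X) :
    Matrix (Fin n) (Fin n) X :=
  Matrix.of fun i j => ∑ k, ∑ l, (α i k * star (α j l)) • x k l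

/-- An (abstract) numerical radius operator space structure on the complex vector space `X`:
norms `W_n` on the matrix spaces `M_n(X)` which satisfy WI and WII. Here `‖α‖` is the operator norm
of `α : ℂ^m → ℂ^n` for the Euclidean norms. (The space `M_0(X)` is zero, so the level `n = 0`
carries no information.) -/
structure NumericalRadiusOperatorSpace (X : Type*) [AddCommGroup X] [Module ℂ X] where
  /-- the norms on the matrix spaces -/
  W : ∀ n : ℕ, Seminorm ℂ (Matrix (Fin n) (Fin n) X)
  eq_zero_of_W_eq_zero : ∀ (n : ℕ) (x : Matrix (Fin n) (Fin n) X), W n x = 0 → x = 0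
  W_directSum : ∀ (m n : ℕ) (x : Matrix (Fin m) (Fin m) X) (y : Matrix (Fin n) (Fin n) X),
    W (m + n) (matrixDirectSum x y) = max (W m x) (W n y)
  W_conj_le : ∀ (m n : ℕ) (α : Matrix (Fin n) (Fin m) ℂ) (x : Matrix (Fin m) (Fin m) X),
    W n (matrixConj α x) ≤ ‖α‖ ^ 2 * W m x

/-- A linear map `φ : X → Y` between numerical radius operator spaces is a `W`-complete isometry if
`W(φ_n(x)) = W(x)` for all `n` and `x ∈ M_n(X)`, where `φ_n([x_ij]) = [φ(x_ij)]`. -/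
def IsWCompleteIsometry {X Y : Type*} [AddCommGroup X] [Module ℂ X] [AddCommGroup Y] [Module ℂ Y]
    (V : NumericalRadiusOperatorSpace X) (V' : NumericalRadiusOperatorSpace Y)
    (φ : X →ₗ[ℂ] Y) : Prop :=
  ∀ (n : ℕ) (x : Matrix (Fin n) (Fin n) X), V'.W n (x.map φ) = V.W n x

theorem norm_inner_le_numericalRadius {K : Type*} [NormedAddCommGroup K] [InnerProductSpace ℂ K]
    (a : K →L[ℂ] K) (ξ : K) : ‖⟪a ξ, ξ⟫_ℂ‖ ≤ numericalRadius a * ‖ξ‖ ^ 2 := by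
  by_cases h : ξ = 0
  · simp [h]
  have hn : ‖ξ‖ ≠ 0 := by simpa using h
  have hb : BddAbove {r : ℝ | ∃ ξ : K, ‖ξ‖ = 1 ∧ r = ‖⟪a ξ, ξ⟫_ℂ‖} := by
    refine ⟨‖a‖, ?_⟩
    rintro r ⟨η, hη, rfl⟩
    calc ‖⟪a η, η⟫_ℂ‖ ≤ ‖a η‖ * ‖η‖ := norm_inner_le_norm _ _
      _ ≤ ‖a‖ * ‖η‖ * ‖η‖ := by gcongr; exact a.le_opNorm η
      _ = ‖a‖ := by simp [hη]
  have h1 : ‖⟪a (((‖ξ‖ : ℂ)⁻¹) • ξ), ((‖ξ‖ : ℂ)⁻¹) • ξ⟫_ℂ‖ ≤ numericalRadius a := by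
    refine le_csSup hb ⟨((‖ξ‖ : ℂ)⁻¹) • ξ, ?_, rfl⟩
    simp [norm_smul, hn]
  rw [map_smul, inner_smul_left, inner_smul_right] at h1
  simp only [norm_mul, RCLike.norm_conj, norm_inv, Complex.norm_real, norm_norm] at h1
  have h2 : ‖⟪a ξ, ξ⟫_ℂ‖ = (‖ξ‖⁻¹ * (‖ξ‖⁻¹ * ‖⟪a ξ, ξ⟫_ℂ‖)) * ‖ξ‖ ^ 2 := by
    field_simp
  rw [h2]
  gcongr

theorem numericalRadius_le {K : Type*} [NormedAddCommGroup K] [InnerProductSpace ℂ K]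
    (a : K →L[ℂ] K) (c : ℝ) (hc : 0 ≤ c) (h : ∀ ξ, ‖⟪a ξ, ξ⟫_ℂ‖ ≤ c * ‖ξ‖ ^ 2) :
    numericalRadius a ≤ c := by
  refine Real.sSup_le ?_ hc
  rintro r ⟨ξ, hξ, rfl⟩
  simpa [hξ] using h ξ

theorem numericalRadius_nonneg {K : Type*} [NormedAddCommGroup K] [InnerProductSpace ℂ K]
    (a : K →L[ℂ] K) : 0 ≤ numericalRadius a := by
  refine Real.sSup_nonneg ?_
  rintro r ⟨ξ, hξ, rfl⟩
  positivity

theorem matrixOperator_apply {H : Type*} [NormedAddCommGroup H] [InnerProductSpace ℂ H]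
    {n : ℕ} (a : Matrix (Fin n) (Fin n) (H →L[ℂ] H)) (ξ : PiLp 2 (fun _ : Fin n => H))
    (i : Fin n) : matrixOperator a ξ i = ∑ j, a i j (ξ j) := by
  simp [matrixOperator]

theorem inner_matrixOperator {H : Type*} [NormedAddCommGroup H] [InnerProductSpace ℂ H]
    {n : ℕ} (a : Matrix (Fin n) (Fin n) (H →L[ℂ] H)) (ξ : PiLp 2 (fun _ : Fin n => H)) :
    ⟪matrixOperator a ξ, ξ⟫_ℂ = ∑ i, ∑ j, ⟪a i j (ξ j), ξ i⟫_ℂ := by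
  simp [PiLp.inner_apply, matrixOperator_apply, sum_inner]

theorem sum_norm_sq_conj_le_of_finiteDimensional {E : Type*} [NormedAddCommGroup E]
    [InnerProductSpace ℂ E] [FiniteDimensional ℂ E] {m n : ℕ} (α : Matrix (Fin n) (Fin m) ℂ)
    (ξ : Fin n → E) :
    ∑ k, ‖∑ i, star (α i k) • ξ i‖ ^ 2 ≤ ‖α‖ ^ 2 * ∑ i, ‖ξ i‖ ^ 2 := by
  let b := stdOrthonormalBasis ℂ E
  have h1 : ∀ v : E, ‖v‖ ^ 2 = ∑ t, ‖⟪b t, v⟫_ℂ‖ ^ 2 := fun v =>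
    (b.sum_sq_norm_inner_right v).symm
  simp_rw [h1]
  rw [Finset.sum_comm, Finset.sum_comm (s := (Finset.univ : Finset (Fin n))), Finset.mul_sum]
  refine Finset.sum_le_sum fun t _ => ?_
  have h2 := Matrix.l2_opNorm_mulVec (α.conjTranspose)
    (WithLp.toLp 2 (fun i => ⟪b t, ξ i⟫_ℂ))
  rw [Matrix.l2_opNorm_conjTranspose] at h2
  have h3 := pow_le_pow_left₀ (norm_nonneg _) h2 2
  rw [mul_pow, EuclideanSpace.norm_sq_eq, EuclideanSpace.norm_sq_eq] at h3
  simpa [inner_sum, inner_smul_right, Matrix.mulVec, dotProduct] using h3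

theorem sum_norm_sq_conj_le {H : Type*} [NormedAddCommGroup H]
    [InnerProductSpace ℂ H] {m n : ℕ} (α : Matrix (Fin n) (Fin m) ℂ) (ξ : Fin n → H) :
    ∑ k, ‖∑ i, star (α i k) • ξ i‖ ^ 2 ≤ ‖α‖ ^ 2 * ∑ i, ‖ξ i‖ ^ 2 := by
  let S := Submodule.span ℂ (Set.range ξ)
  have : FiniteDimensional ℂ S := FiniteDimensional.span_of_finite ℂ (Set.finite_range ξ)
  have := sum_norm_sq_conj_le_of_finiteDimensional (E := S) α
    (fun i => ⟨ξ i, Submodule.subset_span ⟨i, rfl⟩⟩)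
  convert this using 4 with k
  · rw [Submodule.coe_norm]
    simp only [Submodule.coe_sum, Submodule.coe_smul]
  · rfl

/-- A subspace `Y ⊆ B(H)` as a (concrete) numerical radius operator space: the norm of
`[y_ij] ∈ M_n(Y)` is the numerical radius `w_n([y_ij])` of the operator `[y_ij] ∈ B(H^n)`. -/
noncomputable def concreteNumericalRadiusOperatorSpace {H : Type*} [NormedAddCommGroup H]
    [InnerProductSpace ℂ H] (Y : Submodule ℂ (H →L[ℂ] H)) : NumericalRadiusOperatorSpace Y where
  W n := Seminorm.of (fun y => numericalRadius (matrixOperator (y.map (fun T => (T : H →L[ℂ] H)))))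
    (by
      intro x y
      refine numericalRadius_le _ _
        (add_nonneg (numericalRadius_nonneg _) (numericalRadius_nonneg _)) fun ξ => ?_
      have h : ⟪matrixOperator ((x + y).map (fun T => (T : H →L[ℂ] H))) ξ, ξ⟫_ℂ =
          ⟪matrixOperator (x.map (fun T => (T : H →L[ℂ] H))) ξ, ξ⟫_ℂ +
          ⟪matrixOperator (y.map (fun T => (T : H →L[ℂ] H))) ξ, ξ⟫_ℂ := by
        simp [inner_matrixOperator, Finset.sum_add_distrib]
      rw [h, add_mul]
      exact (norm_add_le _ _).trans (add_le_add (norm_inner_le_numericalRadius _ _)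
        (norm_inner_le_numericalRadius _ _)))
    (by
      have key : ∀ (c : ℂ) (x : Matrix (Fin n) (Fin n) Y),
          numericalRadius (matrixOperator ((c • x).map (fun T => (T : H →L[ℂ] H)))) ≤
          ‖c‖ * numericalRadius (matrixOperator (x.map (fun T => (T : H →L[ℂ] H)))) := by
        intro c x
        refine numericalRadius_le _ _ (mul_nonneg (norm_nonneg _) (numericalRadius_nonneg _))
          fun ξ => ?_
        have h : ⟪matrixOperator ((c • x).map (fun T => (T : H →L[ℂ] H))) ξ, ξ⟫_ℂ =
            star c * ⟪matrixOperator (x.map (fun T => (T : H →L[ℂ] H))) ξ, ξ⟫_ℂ := by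
          simp [inner_matrixOperator, Finset.mul_sum, mul_comm]
        rw [h, norm_mul, norm_star, mul_assoc]
        exact mul_le_mul_of_nonneg_left (norm_inner_le_numericalRadius _ _) (norm_nonneg _)
      intro c x
      refine le_antisymm (key c x) ?_
      by_cases hc : c = 0
      · simpa [hc] using numericalRadius_nonneg _
      · have h := key c⁻¹ (c • x)
        rw [inv_smul_smul₀ hc, norm_inv] at h
        have hn : 0 < ‖c‖ := norm_pos_iff.2 hc
        calc _ ≤ ‖c‖ * (‖c‖⁻¹ * _) := mul_le_mul_of_nonneg_left h hn.le
          _ = _ := by rw [← mul_assoc, mul_inv_cancel₀ hn.ne', one_mul])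
  eq_zero_of_W_eq_zero n x hx := by
    change numericalRadius (matrixOperator (x.map (fun T => (T : H →L[ℂ] H)))) = 0 at hx
    set a := x.map (fun T => (T : H →L[ℂ] H)) with ha
    have h0 : ((matrixOperator a : _ →L[ℂ] _) :
        PiLp 2 (fun _ : Fin n => H) →ₗ[ℂ] PiLp 2 (fun _ : Fin n => H)) = 0 := by
      rw [← inner_map_self_eq_zero]
      intro ξ
      have := norm_inner_le_numericalRadius (matrixOperator a) ξ
      rw [hx, zero_mul] at this
      simpa using this
    ext i j v
    have h1 : matrixOperator a (PiLp.single 2 j v) i = 0 := by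
      have := LinearMap.congr_fun h0 (PiLp.single 2 j v)
      simpa using congrArg (fun ζ : PiLp 2 (fun _ : Fin n => H) => ζ i) this
    rw [matrixOperator_apply, Finset.sum_eq_single j] at h1
    · simpa [ha] using h1
    · intro l _ hl
      simp [hl]
    · simp
  W_directSum m n x y := by
    change numericalRadius (matrixOperator ((matrixDirectSum x y).map
      (fun T => (T : H →L[ℂ] H)))) =
      max (numericalRadius (matrixOperator (x.map (fun T => (T : H →L[ℂ] H)))))
        (numericalRadius (matrixOperator (y.map (fun T => (T : H →L[ℂ] H)))))
    have key : ∀ (η : PiLp 2 (fun _ : Fin m => H)) (ζ : PiLp 2 (fun _ : Fin n => H))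
        (ξ : PiLp 2 (fun _ : Fin (m + n) => H)), (∀ i, ξ (Fin.castAdd n i) = η i) →
        (∀ i, ξ (Fin.natAdd m i) = ζ i) →
        ⟪matrixOperator ((matrixDirectSum x y).map (fun T => (T : H →L[ℂ] H))) ξ, ξ⟫_ℂ =
        ⟪matrixOperator (x.map (fun T => (T : H →L[ℂ] H))) η, η⟫_ℂ +
        ⟪matrixOperator (y.map (fun T => (T : H →L[ℂ] H))) ζ, ζ⟫_ℂ ∧
        ‖ξ‖ ^ 2 = ‖η‖ ^ 2 + ‖ζ‖ ^ 2 := by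
      intro η ζ ξ h1 h2
      constructor
      · simp [inner_matrixOperator, Fin.sum_univ_add, matrixDirectSum, h1, h2]
      · simp [PiLp.norm_sq_eq_of_L2, Fin.sum_univ_add, h1, h2]
    refine le_antisymm ?_ (max_le ?_ ?_)
    · refine numericalRadius_le _ _ (le_max_of_le_left (numericalRadius_nonneg _)) fun ξ => ?_
      obtain ⟨h1, h2⟩ := key (WithLp.toLp 2 fun i => ξ (Fin.castAdd n i))
        (WithLp.toLp 2 fun i => ξ (Fin.natAdd m i)) ξ (fun _ => rfl) (fun _ => rfl)
      rw [h1, h2, mul_add]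
      refine (norm_add_le _ _).trans (add_le_add ?_ ?_)
      · refine (norm_inner_le_numericalRadius _ _).trans ?_
        gcongr
        exact le_max_left _ _
      · refine (norm_inner_le_numericalRadius _ _).trans ?_
        gcongr
        exact le_max_right _ _
    · refine numericalRadius_le _ _ (numericalRadius_nonneg _) fun η => ?_
      obtain ⟨h1, h2⟩ := key η 0 (WithLp.toLp 2 (Fin.append η (fun _ => 0)))
        (fun _ => by simp) (fun _ => by simp)
      have h3 := norm_inner_le_numericalRadius (matrixOperator ((matrixDirectSum x y).map
        (fun T => (T : H →L[ℂ] H)))) (WithLp.toLp 2 (Fin.append η (fun _ => 0)))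
      rw [h1, h2] at h3
      simpa using h3
    · refine numericalRadius_le _ _ (numericalRadius_nonneg _) fun ζ => ?_
      obtain ⟨h1, h2⟩ := key 0 ζ (WithLp.toLp 2 (Fin.append (fun _ => 0) ζ))
        (fun _ => by simp) (fun _ => by simp)
      have h3 := norm_inner_le_numericalRadius (matrixOperator ((matrixDirectSum x y).map
        (fun T => (T : H →L[ℂ] H)))) (WithLp.toLp 2 (Fin.append (fun _ => 0) ζ))
      rw [h1, h2] at h3
      simpa using h3
  W_conj_le m n α x := by
    change numericalRadius (matrixOperator ((matrixConj α x).map (fun T => (T : H →L[ℂ] H)))) ≤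
      ‖α‖ ^ 2 * numericalRadius (matrixOperator (x.map (fun T => (T : H →L[ℂ] H))))
    refine numericalRadius_le _ _ (mul_nonneg (sq_nonneg _) (numericalRadius_nonneg _))
      fun ξ => ?_
    set η : PiLp 2 (fun _ : Fin m => H) := WithLp.toLp 2 fun k => ∑ i, star (α i k) • ξ i with hη
    have h1 : ⟪matrixOperator ((matrixConj α x).map (fun T => (T : H →L[ℂ] H))) ξ, ξ⟫_ℂ =
        ⟪matrixOperator (x.map (fun T => (T : H →L[ℂ] H))) η, η⟫_ℂ := by
      simp only [inner_matrixOperator, hη, matrixConj, Matrix.map_apply, Matrix.of_apply,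
        Submodule.coe_sum, Submodule.coe_smul, sum_apply, smul_apply, map_sum, map_smul, sum_inner, inner_sum,
        inner_smul_left, inner_smul_right]
      refine (Finset.sum_congr rfl fun i _ => Finset.sum_comm).trans (Finset.sum_comm.trans
        (Finset.sum_congr rfl fun k _ => (Finset.sum_congr rfl fun i _ => Finset.sum_comm).trans
        (Finset.sum_comm.trans (Finset.sum_congr rfl fun l _ => Finset.sum_congr rfl
        fun i _ => ?_))))
      rw [Finset.mul_sum]
      refine Finset.sum_congr rfl fun j _ => ?_
      simp [mul_assoc]
    have h2 : ‖η‖ ^ 2 ≤ ‖α‖ ^ 2 * ‖ξ‖ ^ 2 := by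
      rw [PiLp.norm_sq_eq_of_L2, PiLp.norm_sq_eq_of_L2]
      exact sum_norm_sq_conj_le α ξ
    rw [h1]
    calc _ ≤ numericalRadius (matrixOperator (x.map (fun T => (T : H →L[ℂ] H)))) * ‖η‖ ^ 2 :=
          norm_inner_le_numericalRadius _ _
      _ ≤ numericalRadius (matrixOperator (x.map (fun T => (T : H →L[ℂ] H)))) *
          (‖α‖ ^ 2 * ‖ξ‖ ^ 2) := mul_le_mul_of_nonneg_left h2 (numericalRadius_nonneg _)
      _ = _ := by ring

end

/-! The representation is a direct sum of maps into matrix algebras, each built from a norming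
functional by a Hahn–Banach and GNS-type argument. For `x` in `M_n(X)`, let `f` be a functional with
`f x = W x` and `‖f‖ ≤ 1` (`exists_dual_vector`). By WI and WII there is a state `p` on `M_n(ℂ)`
with `|f(α y α^*)| ≤ p(α α^*) W(y)` for all `α`, `y` of all sizes (`exists_dominating_state`); this
is the heart of the proof. Adding `ε` to the density matrix of `p` makes it an invertible `T^* T`,
and compressing `[f(e_kl ⊗ ·)]` by `S = T⁻¹` gives `φ : X → B(ℂ^n)`. The quadratic form of `φ_m(y)`
at `ξ` is, up to conjugation, `f(α y α^*)`, where `α` has columns `conj (S ξ_i)`; domination gives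
`w(φ_m(y)) ≤ W(y)`, and the vector `ξ_i = T e_i`, for which `α = 1`, gives `W(x) ≤ (1 + ε n)
w(φ_n(x))`. The numerical radius of a direct sum is the supremum over the summands, so summing over
all `x` and `ε → 0` yields equality. -/

section

open scoped InnerProductSpace Matrix.Norms.L2Operator

/-! ### Algebra of `α x α^*`. -/

section MatrixConj

variable {X : Type*} [AddCommGroup X] [Module ℂ X]

/-- Concatenating rows turns a sum into a single `γ z γ^*` with `z` block diagonal. Together with
the matching identity for `γ γ^*`, this is how WI makes `dominationCone` closed under addition. -/
theorem matrixConj_append {n m k : ℕ} (α : Matrix (Fin n) (Fin m) ℂ) (β : Matrix (Fin n) (Fin k) ℂ)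
    (x : Matrix (Fin m) (Fin m) X) (y : Matrix (Fin k) (Fin k) X) :
    matrixConj (Matrix.of fun i => Fin.append (α i) (β i)) (matrixDirectSum x y) =
      matrixConj α x + matrixConj β y := by
  ext i j
  simp [matrixConj, matrixDirectSum, Fin.sum_univ_add]

theorem append_mul_conjTranspose_append {n m k : ℕ} (α : Matrix (Fin n) (Fin m) ℂ)
    (β : Matrix (Fin n) (Fin k) ℂ) :
    (Matrix.of fun i => Fin.append (α i) (β i)) * (Matrix.of fun i => Fin.append (α i) (β i)).conjTranspose
      = α * α.conjTranspose + β * β.conjTranspose := by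
  ext i j
  simp [Matrix.mul_apply, Fin.sum_univ_add]

theorem matrixConj_smul_left {n m : ℕ} (c : ℂ) (α : Matrix (Fin n) (Fin m) ℂ)
    (x : Matrix (Fin m) (Fin m) X) :
    matrixConj (c • α) x = (c * star c) • matrixConj α x := by
  ext i j
  simp only [matrixConj, Matrix.of_apply, Matrix.smul_apply, Finset.smul_sum, smul_smul,
    smul_eq_mul, star_mul']
  refine Finset.sum_congr rfl fun k _ => Finset.sum_congr rfl fun l _ => ?_
  congr 1
  ring

theorem matrixConj_smul_right {n m : ℕ} (c : ℂ) (α : Matrix (Fin n) (Fin m) ℂ)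
    (x : Matrix (Fin m) (Fin m) X) :
    matrixConj α (c • x) = c • matrixConj α x := by
  ext i j
  simp only [matrixConj, Matrix.of_apply, Matrix.smul_apply, Finset.smul_sum, smul_smul]
  simp only [mul_comm c]

theorem matrixConj_zero_right {n m : ℕ} (α : Matrix (Fin n) (Fin m) ℂ) :
    matrixConj α (0 : Matrix (Fin m) (Fin m) X) = 0 := by
  ext i j
  simp [matrixConj]

theorem matrixConj_one {n : ℕ} (x : Matrix (Fin n) (Fin n) X) : matrixConj 1 x = x := by
  ext i j
  simp [matrixConj, Matrix.one_apply, ite_smul, apply_ite]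

end MatrixConj

/-! ### Norming functionals and dominating states. -/

namespace NumericalRadiusOperatorSpace

variable {X : Type*} [AddCommGroup X] [Module ℂ X] (V : NumericalRadiusOperatorSpace X)

theorem exists_dual_vector {n : ℕ} (x : Matrix (Fin n) (Fin n) X) :
    ∃ f : Matrix (Fin n) (Fin n) X →ₗ[ℂ] ℂ, f x = V.W n x ∧ ∀ y, ‖f y‖ ≤ V.W n y := by
  by_cases hx : x = 0
  · exact ⟨0, by simp [hx], by simp⟩
  let g : Matrix (Fin n) (Fin n) X →ₗ.[ℂ] ℂ := LinearPMap.mkSpanSingleton x (V.W n x : ℂ) hx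
  obtain ⟨f, hf, hle⟩ := Module.Dual.exists_extension_of_le_seminorm g.domain g.toFun
    (p := V.W n) (by
      rintro ⟨y, hy⟩
      obtain ⟨c, rfl⟩ := Submodule.mem_span_singleton.1 hy
      have : g.toFun ⟨c • x, hy⟩ = c • (V.W n x : ℂ) := LinearPMap.mkSpanSingleton'_apply _ _ _ _ _
      rw [this]
      simp [map_smul_eq_mul, abs_of_nonneg (apply_nonneg (V.W n) x)])
  refine ⟨f, ?_, hle⟩
  have h := hf ⟨x, Submodule.mem_span_singleton_self x⟩
  exact h.trans (LinearPMap.mkSpanSingleton'_apply_self _ _ _ _)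

/-- The cone of matrices whose real part is `α α^* - Re f(α y α^*)` for some `α` and some `y` in the
unit ball. -/
noncomputable def dominationCone {n : ℕ} (f : Matrix (Fin n) (Fin n) X →ₗ[ℂ] ℂ) :
    PointedCone ℝ (Matrix (Fin n) (Fin n) ℂ) where
  -- Only `h + h^*` enters, so every skew-Hermitian matrix lies in the cone together with its
  -- negative; a functional that is nonnegative on the cone must vanish on them.
  carrier := {h | ∃ (m : ℕ) (α : Matrix (Fin n) (Fin m) ℂ) (y : Matrix (Fin m) (Fin m) X),
    V.W m y ≤ 1 ∧ h + h.conjTranspose =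
      (2 : ℝ) • (α * α.conjTranspose - (f (matrixConj α y)).re • 1)}
  zero_mem' := ⟨0, 0, 0, by simp, by simp [matrixConj_zero_right]⟩
  add_mem' := by
    rintro h h' ⟨m, α, y, hy, e⟩ ⟨k, β, z, hz, e'⟩
    refine ⟨m + k, Matrix.of fun i => Fin.append (α i) (β i), matrixDirectSum y z, ?_, ?_⟩
    · rw [V.W_directSum]; exact max_le hy hz
    · rw [append_mul_conjTranspose_append, matrixConj_append, map_add, Complex.add_re, add_smul,
        Matrix.conjTranspose_add, add_add_add_comm, e, e', ← smul_add]
      congr 1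
      abel
  smul_mem' := by
    rintro ⟨c, hc0⟩ h ⟨m, α, y, hy, e⟩
    -- The square root appears because `α ↦ α y α^*` is quadratic in `α`.
    have hc : (√c : ℂ) * star (√c : ℂ) = (c : ℂ) := by
      rw [Complex.star_def, Complex.conj_ofReal, ← Complex.ofReal_mul, Real.mul_self_sqrt hc0]
    refine ⟨m, (√c : ℂ) • α, y, hy, ?_⟩
    change c • h + (c • h).conjTranspose = _
    rw [matrixConj_smul_left, hc, map_smul, Matrix.conjTranspose_smul (√c : ℂ), Matrix.smul_mul,
      Matrix.mul_smul, smul_smul, hc, Matrix.conjTranspose_smul, star_trivial, ← smul_add, e,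
      smul_comm, smul_sub, smul_smul, smul_eq_mul, Complex.re_ofReal_mul, Complex.coe_smul]

-- The identity is an order unit: `c = ‖h‖` works. This supplies the cofinality hypothesis of
-- `riesz_extension`.
open scoped MatrixOrder ComplexOrder in
theorem _root_.Matrix.IsHermitian.exists_smul_one_add_eq {n : ℕ} {h : Matrix (Fin n) (Fin n) ℂ}
    (hh : h.IsHermitian) :
    ∃ (c : ℝ) (α : Matrix (Fin n) (Fin n) ℂ), c • 1 + h = α * α.conjTranspose := by
  have h1 := IsSelfAdjoint.neg_algebraMap_norm_le_self (a := h) hh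
  have h2 : 0 ≤ ‖h‖ • (1 : Matrix (Fin n) (Fin n) ℂ) + h := by
    rw [Algebra.algebraMap_eq_smul_one] at h1
    exact neg_le_iff_add_nonneg'.1 h1
  obtain ⟨β, hβ⟩ := CStarAlgebra.nonneg_iff_eq_star_mul_self.1 h2
  exact ⟨‖h‖, β.conjTranspose, by simpa [Matrix.star_eq_conjTranspose] using hβ⟩

/-- The functional `c • 1 ↦ c` is nonnegative on the part of the cone inside `ℝ • 1`, and the Riesz
extension theorem extends it to `p`. Nonnegativity of `p` at `α α^* - Re f(α y α^*) • 1` is exactly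
the desired domination. -/
theorem exists_dominating_state {n : ℕ} [NeZero n] (f : Matrix (Fin n) (Fin n) X →ₗ[ℂ] ℂ)
    (hf : ∀ y, ‖f y‖ ≤ V.W n y) :
    ∃ p : Matrix (Fin n) (Fin n) ℂ →ₗ[ℝ] ℝ, p 1 = 1 ∧ (∀ h, p h.conjTranspose = p h) ∧
      (∀ (m : ℕ) (α : Matrix (Fin n) (Fin m) ℂ), 0 ≤ p (α * α.conjTranspose)) ∧
      ∀ (m : ℕ) (α : Matrix (Fin n) (Fin m) ℂ) (y : Matrix (Fin m) (Fin m) X),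
        ‖f (matrixConj α y)‖ ≤ p (α * α.conjTranspose) * V.W m y := by
  have h1 : (1 : Matrix (Fin n) (Fin n) ℂ) ≠ 0 := one_ne_zero
  let g : Matrix (Fin n) (Fin n) ℂ →ₗ.[ℝ] ℝ := LinearPMap.mkSpanSingleton 1 (1 : ℝ) h1
  have hg : ∀ (c : ℝ) (hc : c • (1 : Matrix (Fin n) (Fin n) ℂ) ∈ g.domain), g ⟨c • 1, hc⟩ = c := by
    intro c hc
    exact (LinearPMap.mkSpanSingleton'_apply _ _ _ _ _).trans (mul_one c)
  obtain ⟨p, hp, hpos⟩ := riesz_extension (V.dominationCone f) g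
    (by
      -- If `c • 1` is in the cone, then `α α^* = (c + t) • 1` with `t = Re f(α y α^*)`, hence `‖α‖
      -- ^ 2 = c + t`. WII gives `t ≤ ‖α‖ ^ 2`, so `c ≥ 0`.
      rintro ⟨x, hx⟩ ⟨m, α, y, hy, e⟩
      obtain ⟨c, rfl⟩ := Submodule.mem_span_singleton.1 hx
      rw [hg]
      set t := (f (matrixConj α y)).re with ht
      have e1 : α * α.conjTranspose = (c + t) • 1 := by
        have : (c • (1 : Matrix (Fin n) (Fin n) ℂ)) + (c • 1 : Matrix (Fin n) (Fin n) ℂ).conjTranspose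
            = (2 : ℝ) • (c • 1) := by
          rw [Matrix.conjTranspose_smul, star_trivial, Matrix.conjTranspose_one, two_smul]
        simp only at e
        rw [this] at e
        have e2 := smul_right_injective _ (two_ne_zero (α := ℝ)) e
        rw [add_smul, e2]
        abel
      have e3 : 0 ≤ c + t := by
        have := congrArg (fun M => (M 0 0).re) e1
        simp [Matrix.mul_apply] at this
        rw [← this]
        exact Finset.sum_nonneg fun i _ => add_nonneg (mul_self_nonneg _) (mul_self_nonneg _)
      have e4 : ‖α‖ ^ 2 = c + t := by
        have h5 := Matrix.l2_opNorm_conjTranspose_mul_self α.conjTranspose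
        rw [Matrix.conjTranspose_conjTranspose, e1, norm_smul, norm_one, mul_one,
          Real.norm_of_nonneg e3, Matrix.l2_opNorm_conjTranspose] at h5
        rw [sq, h5]
      have e5 : t ≤ ‖α‖ ^ 2 := calc
        t ≤ ‖f (matrixConj α y)‖ := Complex.re_le_norm _
        _ ≤ ‖α‖ ^ 2 * V.W m y := (hf _).trans (V.W_conj_le _ _ _ _)
        _ ≤ ‖α‖ ^ 2 := mul_le_of_le_one_right (sq_nonneg _) hy
      linarith)
    (by
      intro h
      have hh : ((1 / 2 : ℝ) • (h + h.conjTranspose)).IsHermitian := by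
        rw [Matrix.IsHermitian, Matrix.conjTranspose_smul, Matrix.conjTranspose_add, star_trivial,
          Matrix.conjTranspose_conjTranspose, add_comm]
      obtain ⟨c, α, hc⟩ := hh.exists_smul_one_add_eq
      refine ⟨⟨c • 1, Submodule.smul_mem _ _ (Submodule.mem_span_singleton_self _)⟩, n, α, 0,
        by simp, ?_⟩
      rw [matrixConj_zero_right, map_zero, Complex.zero_re, zero_smul, sub_zero, ← hc,
        Matrix.conjTranspose_add, Matrix.conjTranspose_smul, star_trivial, Matrix.conjTranspose_one]
      module)
  have hp1 : p 1 = 1 := by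
    have := hp ⟨(1 : ℝ) • 1, Submodule.smul_mem _ _ (Submodule.mem_span_singleton_self _)⟩
    rw [hg] at this
    simpa using this
  have hskew : ∀ h : Matrix (Fin n) (Fin n) ℂ, h + h.conjTranspose = 0 → 0 ≤ p h := fun h hh =>
    hpos h ⟨0, 0, 0, by simp, by simp [hh, matrixConj_zero_right]⟩
  have hdom : ∀ (m : ℕ) (α : Matrix (Fin n) (Fin m) ℂ) (y : Matrix (Fin m) (Fin m) X),
      V.W m y ≤ 1 → (f (matrixConj α y)).re ≤ p (α * α.conjTranspose) := by
    intro m α y hy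
    have h2 := hpos (α * α.conjTranspose - (f (matrixConj α y)).re • 1) ⟨m, α, y, hy, by
      rw [Matrix.conjTranspose_sub, Matrix.conjTranspose_smul, star_trivial,
        Matrix.conjTranspose_one, Matrix.conjTranspose_mul, Matrix.conjTranspose_conjTranspose,
        two_smul]⟩
    rw [map_sub, map_smul, hp1, smul_eq_mul, mul_one] at h2
    linarith
  refine ⟨p, hp1, ?_, fun m α => by simpa [matrixConj_zero_right] using hdom m α 0 (by simp), ?_⟩
  · intro h
    have h2 := hskew (h - h.conjTranspose) (by simp)
    have h3 := hskew (h.conjTranspose - h) (by simp)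
    rw [map_sub] at h2 h3
    linarith
  · intro m α y
    have hball : ∀ y, V.W m y ≤ 1 → ‖f (matrixConj α y)‖ ≤ p (α * α.conjTranspose) := by
      intro y hy
      -- Rotating `y` by a phase upgrades the bound on the real part to one on the modulus.
      obtain ⟨c, hc, hcy⟩ := RCLike.exists_norm_eq_mul_self (f (matrixConj α y))
      have h2 := hdom m α (c • y) (by rwa [map_smul_eq_mul, hc, one_mul])
      rw [matrixConj_smul_right, map_smul, smul_eq_mul, ← hcy] at h2
      simpa using h2
    by_cases hy : V.W m y = 0
    · rw [V.eq_zero_of_W_eq_zero m y hy]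
      simp [matrixConj_zero_right]
    · have hpos' : 0 < V.W m y := lt_of_le_of_ne (apply_nonneg _ _) (Ne.symm hy)
      have h2 := hball ((((V.W m y)⁻¹ : ℝ) : ℂ) • y) (by
        rw [map_smul_eq_mul, Complex.norm_real, Real.norm_of_nonneg (inv_nonneg.2 hpos'.le),
          inv_mul_cancel₀ hy])
      rw [matrixConj_smul_right, map_smul, norm_smul, Complex.norm_real,
        Real.norm_of_nonneg (inv_nonneg.2 hpos'.le), inv_mul_le_iff₀ hpos'] at h2
      linarith

end NumericalRadiusOperatorSpace

/-! ### Density matrices of states and their invertible perturbations. -/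

section DensityMatrix

variable {n : ℕ}

/-- The matrix `P` representing a real functional `p` on matrices by `p h = Re ∑ h_kl P_kl`. -/
noncomputable def densityMatrix (p : Matrix (Fin n) (Fin n) ℂ →ₗ[ℝ] ℝ) :
    Matrix (Fin n) (Fin n) ℂ :=
  Matrix.of fun k l => ⟨p (Matrix.single k l 1), -p (Matrix.single k l Complex.I)⟩

theorem re_sum_mul_densityMatrix (p : Matrix (Fin n) (Fin n) ℂ →ₗ[ℝ] ℝ)
    (h : Matrix (Fin n) (Fin n) ℂ) :
    (∑ k, ∑ l, h k l * densityMatrix p k l).re = p h := by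
  have key : ∀ k l (z : ℂ), p (Matrix.single k l z) = (z * densityMatrix p k l).re := by
    intro k l z
    have : Matrix.single k l z = z.re • Matrix.single k l (1 : ℂ) +
        z.im • Matrix.single k l Complex.I := by
      rw [Matrix.smul_single, Matrix.smul_single, ← Matrix.single_add]
      congr 1
      simp
    rw [this, map_add, map_smul, map_smul]
    simp [densityMatrix]
  conv_rhs => rw [Matrix.matrix_eq_sum_single h]
  simp only [map_sum, key, Complex.re_sum]

theorem isHermitian_densityMatrix {p : Matrix (Fin n) (Fin n) ℂ →ₗ[ℝ] ℝ}
    (hp : ∀ h, p h.conjTranspose = p h) : (densityMatrix p).IsHermitian := by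
  ext k l
  have h1 := hp (Matrix.single l k 1)
  have h2 := hp (Matrix.single l k Complex.I)
  have h3 : Matrix.single k l (-Complex.I) = -Matrix.single k l Complex.I := by
    ext; simp [Matrix.single_apply, apply_ite]
  rw [Matrix.conjTranspose_single] at h1 h2
  simp only [star_one, Complex.star_def, Complex.conj_I, h3, map_neg] at h1 h2
  apply Complex.ext <;> simp [densityMatrix, h1, ← h2]

/-- The pairing `∑ h_kl P_kl` has no transpose, so `v^* P v` corresponds to `h_kl = conj (v_k) v_l`.
This is why the columns of `α` are conjugated here and below. -/
theorem re_sum_star_dotProduct_densityMatrix {m : ℕ} (p : Matrix (Fin n) (Fin n) ℂ →ₗ[ℝ] ℝ)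
    (v : Fin m → Fin n → ℂ) :
    (∑ i, star (v i) ⬝ᵥ (densityMatrix p).mulVec (v i)).re =
      p ((Matrix.of fun k i => star (v i k)) * (Matrix.of fun k i => star (v i k)).conjTranspose) := by
  rw [← re_sum_mul_densityMatrix]
  congr 1
  simp only [dotProduct, Matrix.mulVec, Matrix.mul_apply, Matrix.conjTranspose_apply,
    Matrix.of_apply, star_star, Finset.mul_sum, Finset.sum_mul, Pi.star_apply]
  rw [Finset.sum_comm]
  refine Finset.sum_congr rfl fun k _ => ?_
  rw [Finset.sum_comm]
  refine Finset.sum_congr rfl fun l _ => Finset.sum_congr rfl fun i _ => ?_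
  ring

open scoped ComplexOrder in
theorem posSemidef_densityMatrix {p : Matrix (Fin n) (Fin n) ℂ →ₗ[ℝ] ℝ}
    (hp : ∀ h, p h.conjTranspose = p h)
    (hpos : ∀ (m : ℕ) (α : Matrix (Fin n) (Fin m) ℂ), 0 ≤ p (α * α.conjTranspose)) :
    (densityMatrix p).PosSemidef := by
  have hH := isHermitian_densityMatrix hp
  refine .of_dotProduct_mulVec_nonneg hH fun v => ?_
  rw [Complex.nonneg_iff]
  refine ⟨?_, (hH.im_star_dotProduct_mulVec_self v).symm⟩
  have := re_sum_star_dotProduct_densityMatrix p (fun _ : Fin 1 => v)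
  simp only [Finset.univ_unique, Finset.sum_const, Finset.card_singleton, one_smul] at this
  rw [this]
  exact hpos _ _

theorem re_star_dotProduct_conjTranspose_mul_self {m : ℕ} (T : Matrix (Fin m) (Fin n) ℂ)
    (v : Fin n → ℂ) :
    (star v ⬝ᵥ (T.conjTranspose * T).mulVec v).re = ‖WithLp.toLp 2 (T.mulVec v)‖ ^ 2 := by
  rw [← Matrix.mulVec_mulVec, Matrix.dotProduct_mulVec, Matrix.vecMul_conjTranspose, star_star,
    EuclideanSpace.norm_sq_eq, dotProduct, Complex.re_sum]
  refine Finset.sum_congr rfl fun i _ => ?_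
  simp only [Pi.star_apply, Complex.star_def]
  rw [mul_comm, Complex.mul_conj, Complex.ofReal_re, Complex.normSq_eq_norm_sq]

open scoped ComplexOrder MatrixOrder in
/-- A state on `M_n(ℂ)` is dominated by a faithful functional of mass `1 + ε`, which is induced by
an invertible matrix `T`. -/
theorem exists_invertible_dominating {p : Matrix (Fin n) (Fin n) ℂ →ₗ[ℝ] ℝ} (hp1 : p 1 = 1)
    (hp : ∀ h, p h.conjTranspose = p h)
    (hpos : ∀ (m : ℕ) (α : Matrix (Fin n) (Fin m) ℂ), 0 ≤ p (α * α.conjTranspose))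
    {ε : ℝ} (hε : 0 < ε) :
    ∃ T S : Matrix (Fin n) (Fin n) ℂ, T * S = 1 ∧ S * T = 1 ∧
      (∀ (m : ℕ) (v : Fin m → Fin n → ℂ),
        p ((Matrix.of fun k i => star (v i k)) * (Matrix.of fun k i => star (v i k)).conjTranspose)
          ≤ ∑ i, ‖WithLp.toLp 2 (T.mulVec (v i))‖ ^ 2) ∧
      ∑ i, ‖WithLp.toLp 2 (T.mulVec (Pi.single i 1))‖ ^ 2 = 1 + ε * n := by
  have hP := posSemidef_densityMatrix hp hpos
  -- The shift by `ε` gives invertibility and raises the trace from `p 1 = 1` to `1 + ε n`.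
  have hD : (densityMatrix p + ((ε : ℝ) : ℂ) • (1 : Matrix (Fin n) (Fin n) ℂ)).PosDef :=
    Matrix.PosDef.posSemidef_add hP (Matrix.PosDef.one.smul (by exact_mod_cast hε))
  obtain ⟨T, hT⟩ := CStarAlgebra.nonneg_iff_eq_star_mul_self.1 hD.posSemidef.nonneg
  rw [Matrix.star_eq_conjTranspose] at hT
  have hTu : IsUnit T := by
    have := hD.isUnit
    rw [hT, Matrix.isUnit_iff_isUnit_det, Matrix.det_mul] at this
    rw [Matrix.isUnit_iff_isUnit_det]
    exact isUnit_of_mul_isUnit_right this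
  have hsum : ∀ (m : ℕ) (v : Fin m → Fin n → ℂ), ∑ i, ‖WithLp.toLp 2 (T.mulVec (v i))‖ ^ 2 =
      p ((Matrix.of fun k i => star (v i k)) * (Matrix.of fun k i => star (v i k)).conjTranspose)
        + ε * ∑ i, ‖WithLp.toLp 2 (v i)‖ ^ 2 := by
    intro m v
    rw [← re_sum_star_dotProduct_densityMatrix, Complex.re_sum, Finset.mul_sum,
      ← Finset.sum_add_distrib]
    refine Finset.sum_congr rfl fun i _ => ?_
    have h1 := re_star_dotProduct_conjTranspose_mul_self (1 : Matrix (Fin n) (Fin n) ℂ) (v i)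
    rw [← re_star_dotProduct_conjTranspose_mul_self, ← hT, Matrix.add_mulVec, dotProduct_add,
      Complex.add_re, Matrix.smul_mulVec, dotProduct_smul, smul_eq_mul, Complex.re_ofReal_mul]
    simp only [Matrix.conjTranspose_one, Matrix.mul_one, Matrix.one_mulVec] at h1 ⊢
    rw [h1]
  obtain ⟨S, hTS, hST⟩ := isUnit_iff_exists.1 hTu
  refine ⟨T, S, hTS, hST, fun m v => ?_, ?_⟩
  · rw [hsum]
    exact le_add_of_nonneg_right (mul_nonneg hε.le (Finset.sum_nonneg fun _ _ => sq_nonneg _))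
  · have h1 : (Matrix.of fun k i : Fin n => star ((Pi.single i 1 : Fin n → ℂ) k)) = 1 := by
      ext k i
      simp [Pi.single_apply, Matrix.one_apply, apply_ite]
    rw [hsum, h1, Matrix.conjTranspose_one, mul_one, hp1]
    simp

end DensityMatrix

/-! ### The map into `B(ℂ^n)` induced by a functional. -/

section CompressedFunctional

variable {X : Type*} [AddCommGroup X] [Module ℂ X] {n : ℕ}

/-- The map `x ↦ S^* [f(e_kl ⊗ x)] S` into `B(ℂ^n)`. -/
noncomputable def compressedFunctional (f : Matrix (Fin n) (Fin n) X →ₗ[ℂ] ℂ)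
    (S : Matrix (Fin n) (Fin n) ℂ) :
    X →ₗ[ℂ] (EuclideanSpace ℂ (Fin n) →L[ℂ] EuclideanSpace ℂ (Fin n)) where
  toFun x := Matrix.toEuclideanCLM (𝕜 := ℂ)
    (S.conjTranspose * (Matrix.of fun k l => f (Matrix.single k l x)) * S)
  map_add' x y := by
    rw [← map_add, ← add_mul, ← mul_add]
    congr 4
    ext k l
    simp [Matrix.single_add]
  map_smul' c x := by
    rw [RingHom.id_apply, ← map_smul, ← smul_mul_assoc, ← mul_smul_comm]
    congr 4
    ext k l
    rw [Matrix.of_apply, ← Matrix.smul_single, map_smul]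
    rfl

theorem inner_compressedFunctional (f : Matrix (Fin n) (Fin n) X →ₗ[ℂ] ℂ)
    (S : Matrix (Fin n) (Fin n) ℂ) (x : X) (u v : EuclideanSpace ℂ (Fin n)) :
    ⟪u, compressedFunctional f S x v⟫_ℂ =
      ∑ k, ∑ l, star (S.mulVec u k) * S.mulVec v l * f (Matrix.single k l x) := by
  have h : ⟪u, compressedFunctional f S x v⟫_ℂ = star (S.mulVec u) ⬝ᵥ
      (Matrix.of fun k l => f (Matrix.single k l x)).mulVec (S.mulVec v) := by
    rw [EuclideanSpace.inner_eq_star_dotProduct, dotProduct_comm, Matrix.mulVec_mulVec,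
      Matrix.star_mulVec, ← Matrix.dotProduct_mulVec, Matrix.mulVec_mulVec, ← mul_assoc]
    rfl
  rw [h]
  generalize S.mulVec u = a
  generalize S.mulVec v = b
  simp only [dotProduct, Matrix.mulVec, Finset.mul_sum, Pi.star_apply, Matrix.of_apply]
  refine Finset.sum_congr rfl fun k _ => Finset.sum_congr rfl fun l _ => ?_
  ring

/-- Every quadratic form of the amplified map is a value of `f` at some `α y α^*`, so bounds on `f`
become bounds on numerical radii. The outer `star` appears because the inner product is
conjugate-linear in its first slot, where the operator stands. -/
theorem inner_matrixOperator_compressedFunctional {m : ℕ} (f : Matrix (Fin n) (Fin n) X →ₗ[ℂ] ℂ)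
    (S : Matrix (Fin n) (Fin n) ℂ) (y : Matrix (Fin m) (Fin m) X)
    (ξ : PiLp 2 (fun _ : Fin m => EuclideanSpace ℂ (Fin n))) :
    star ⟪matrixOperator (y.map (compressedFunctional f S)) ξ, ξ⟫_ℂ =
      f (matrixConj (Matrix.of fun k i => star (S.mulVec (ξ i) k)) y) := by
  have hsingle : ∀ k l, f (Matrix.single k l
      (matrixConj (Matrix.of fun k i => star (S.mulVec (ξ i) k)) y k l)) =
      ∑ i, ∑ j, star (S.mulVec (ξ i) k) * S.mulVec (ξ j) l * f (Matrix.single k l (y i j)) := by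
    intro k l
    have h1 : ∀ g : X →ₗ[ℂ] ℂ, g (matrixConj (Matrix.of fun k i => star (S.mulVec (ξ i) k)) y k l)
        = ∑ i, ∑ j, star (S.mulVec (ξ i) k) * S.mulVec (ξ j) l * g (y i j) := by
      intro g
      simp [matrixConj, map_sum]
    exact h1 (f ∘ₗ Matrix.singleLinearMap ℂ k l)
  rw [inner_matrixOperator]
  conv_rhs => rw [Matrix.matrix_eq_sum_single (matrixConj _ y)]
  simp only [map_sum, star_sum, hsingle, Matrix.map_apply]
  simp only [Complex.star_def, inner_conj_symm]
  simp only [inner_compressedFunctional, ← Complex.star_def]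
  have e1 : ∀ F : Fin m → Fin m → Fin n → Fin n → ℂ,
      ∑ i, ∑ j, ∑ k, ∑ l, F i j k l = ∑ k, ∑ l, ∑ i, ∑ j, F i j k l := by
    intro F
    calc _ = ∑ i, ∑ k, ∑ l, ∑ j, F i j k l := Finset.sum_congr rfl fun i _ => by
          rw [Finset.sum_comm]
          exact Finset.sum_congr rfl fun k _ => Finset.sum_comm
      _ = _ := by
          rw [Finset.sum_comm]
          exact Finset.sum_congr rfl fun k _ => Finset.sum_comm
  exact e1 _

end CompressedFunctional

/-! ### Almost norming finite-dimensional representations. -/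

namespace NumericalRadiusOperatorSpace

variable {X : Type*} [AddCommGroup X] [Module ℂ X] (V : NumericalRadiusOperatorSpace X)

/-- Every matrix over `X` is almost normed by a completely contractive map into some `M_n(ℂ)`. -/
theorem exists_finiteDimensional_representation {n : ℕ} (x : Matrix (Fin n) (Fin n) X) {ε : ℝ}
    (hε : 0 < ε) :
    ∃ φ : X →ₗ[ℂ] (EuclideanSpace ℂ (Fin n) →L[ℂ] EuclideanSpace ℂ (Fin n)),
      (∀ (m : ℕ) (y : Matrix (Fin m) (Fin m) X), numericalRadius (matrixOperator (y.map φ)) ≤ V.W m y) ∧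
      V.W n x ≤ numericalRadius (matrixOperator (x.map φ)) * (1 + ε * n) := by
  -- There is no state on `M_0(ℂ)`, where `1 = 0`; this level is trivial.
  rcases Nat.eq_zero_or_pos n with rfl | hn
  · refine ⟨0, fun m y => numericalRadius_le _ _ (apply_nonneg _ _) fun ξ => ?_, ?_⟩
    · rw [Subsingleton.elim (matrixOperator _ ξ) 0, inner_zero_left, norm_zero]
      exact mul_nonneg (apply_nonneg _ _) (sq_nonneg _)
    · rw [Subsingleton.elim x 0, map_zero]
      exact mul_nonneg (numericalRadius_nonneg _) (by simp)
  have : NeZero n := ⟨hn.ne'⟩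
  obtain ⟨f, hfx, hf⟩ := V.exists_dual_vector x
  obtain ⟨p, hp1, hp, hpos, hdom⟩ := V.exists_dominating_state f hf
  obtain ⟨T, S, hTS, hST, hle, hsum⟩ := exists_invertible_dominating hp1 hp hpos hε
  refine ⟨compressedFunctional f S, fun m y => ?_, ?_⟩
  · refine numericalRadius_le _ _ (apply_nonneg _ _) fun ξ => ?_
    rw [← norm_star, inner_matrixOperator_compressedFunctional]
    refine (hdom _ _ _).trans ?_
    rw [mul_comm]
    refine mul_le_mul_of_nonneg_left ((hle m fun i => S.mulVec (ξ i)).trans_eq ?_)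
      (apply_nonneg _ _)
    simp [Matrix.mulVec_mulVec, hTS, PiLp.norm_sq_eq_of_L2]
  -- Since `S` inverts `T`, the vectors `T e_i` produce `α = 1`, and the form takes the value `f x =
  -- W x` at a vector of squared norm `1 + ε n`.
  · let ξ : PiLp 2 (fun _ : Fin n => EuclideanSpace ℂ (Fin n)) :=
      WithLp.toLp 2 fun i => WithLp.toLp 2 (T.mulVec (Pi.single i 1))
    have h1 : ‖ξ‖ ^ 2 = 1 + ε * n := by rw [PiLp.norm_sq_eq_of_L2]; exact hsum
    have h2 : (Matrix.of fun k i => star (S.mulVec (ξ i) k)) = 1 := by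
      ext k i
      change star (S.mulVec (T.mulVec (Pi.single i 1)) k) = _
      rw [Matrix.mulVec_mulVec, hST, Matrix.one_mulVec]
      simp [Pi.single_apply, Matrix.one_apply, apply_ite]
    have h3 := norm_inner_le_numericalRadius (matrixOperator (x.map (compressedFunctional f S))) ξ
    rw [← norm_star, inner_matrixOperator_compressedFunctional, h2, matrixConj_one, hfx, h1,
      Complex.norm_real, Real.norm_of_nonneg (apply_nonneg _ _)] at h3
    exact h3

end NumericalRadiusOperatorSpace

/-! ### Direct sums of operators and their numerical radii. -/

section DirectSumOfOperators

/-- At the vector `(u, v)` the form is `⟪a v, u⟫`, so operator norms are controlled by numerical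
radii one level up. This bounds a family of `W`-contractive maps uniformly, so that its direct sum
is a bounded operator. -/
theorem norm_le_two_mul_numericalRadius_offDiagonal {H : Type*} [NormedAddCommGroup H]
    [InnerProductSpace ℂ H] (a : H →L[ℂ] H) :
    ‖a‖ ≤ 2 * numericalRadius (matrixOperator !![0, a; 0, 0]) := by
  set w := numericalRadius (matrixOperator !![0, a; 0, 0])
  have hw : 0 ≤ w := numericalRadius_nonneg _
  have key : ∀ u v : H, ‖⟪a v, u⟫_ℂ‖ ≤ w * (‖u‖ ^ 2 + ‖v‖ ^ 2) := by
    intro u v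
    have := norm_inner_le_numericalRadius (matrixOperator !![0, a; 0, 0]) (WithLp.toLp 2 ![u, v])
    rw [inner_matrixOperator, PiLp.norm_sq_eq_of_L2] at this
    simpa [Fin.sum_univ_two] using this
  refine a.opNorm_le_bound (by positivity) fun v => ?_
  by_cases h0 : a v = 0
  · rw [h0, norm_zero]; positivity
  have hav : 0 < ‖a v‖ := norm_pos_iff.2 h0
  have hv : 0 < ‖v‖ := norm_pos_iff.2 fun h => h0 (by rw [h, map_zero])
  -- Take `u` parallel to `a v` with `‖u‖ = ‖v‖`.
  have h1 := key (((‖v‖ / ‖a v‖ : ℝ) : ℂ) • a v) v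
  have h2 : ‖((‖v‖ / ‖a v‖ : ℝ) : ℂ) • a v‖ = ‖v‖ := by
    rw [norm_smul, Complex.norm_real, Real.norm_of_nonneg (by positivity),
      div_mul_cancel₀ _ hav.ne']
  have h3 : ‖⟪a v, ((‖v‖ / ‖a v‖ : ℝ) : ℂ) • a v⟫_ℂ‖ = ‖v‖ * ‖a v‖ := by
    rw [inner_smul_right, inner_self_eq_norm_sq_to_K, norm_mul, Complex.norm_real,
      Real.norm_of_nonneg (by positivity), norm_pow, RCLike.norm_ofReal, abs_norm]
    field_simp
  rw [h2, h3] at h1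
  have h4 : ‖v‖ * ‖a v‖ ≤ ‖v‖ * (2 * w * ‖v‖) := h1.trans_eq (by ring)
  exact le_of_mul_le_mul_left h4 hv

variable {ι : Type*} {G : ι → Type*} [∀ i, NormedAddCommGroup (G i)]

theorem lp_summable_norm_sq (f : lp G 2) : Summable fun i => ‖f i‖ ^ 2 := by
  have := (lp.memℓp f).summable (by norm_num)
  simpa using this

theorem memℓp_two_of_norm_le {C : ℝ} (f : lp G 2) {g : ∀ i, G i} (h : ∀ i, ‖g i‖ ≤ C * ‖f i‖) :
    Memℓp g 2 := by
  refine memℓp_gen ?_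
  refine Summable.of_nonneg_of_le (fun i => by positivity) (fun i => ?_)
    ((lp_summable_norm_sq f).mul_left (C ^ 2))
  simp only [ENNReal.toReal_ofNat, Real.rpow_two]
  rw [← mul_pow]
  exact pow_le_pow_left₀ (norm_nonneg _) (h i) 2

theorem lp_hasSum_norm_sq (f : lp G 2) : HasSum (fun i => ‖f i‖ ^ 2) (‖f‖ ^ 2) := by
  have := lp.hasSum_norm (p := 2) (by norm_num) f
  simpa using this

variable [∀ i, InnerProductSpace ℂ (G i)]

/-- The direct sum of a uniformly bounded family of operators. -/
noncomputable def directSumOperator (A : ∀ i, G i →L[ℂ] G i) (C : ℝ) (hC : 0 ≤ C)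
    (hA : ∀ i, ‖A i‖ ≤ C) : lp G 2 →L[ℂ] lp G 2 :=
  LinearMap.mkContinuous
    { toFun := fun f => ⟨fun i => A i (f i), memℓp_two_of_norm_le f fun i =>
        (A i).le_of_opNorm_le (hA i) (f i)⟩
      map_add' := fun f g => by ext i; exact map_add (A i) _ _
      map_smul' := fun c f => by ext i; exact map_smul (A i) c _ }
    C fun f => by
      refine (sq_le_sq₀ (norm_nonneg _) (by positivity)).1 ?_
      rw [mul_pow]
      refine hasSum_le (fun i => ?_) (lp_hasSum_norm_sq _) ((lp_hasSum_norm_sq f).mul_left _)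
      rw [← mul_pow]
      exact pow_le_pow_left₀ (norm_nonneg _) ((A i).le_of_opNorm_le (hA i) (f i)) 2

theorem directSumOperator_apply (A : ∀ i, G i →L[ℂ] G i) (C : ℝ) (hC : 0 ≤ C)
    (hA : ∀ i, ‖A i‖ ≤ C) (f : lp G 2) (i : ι) : directSumOperator A C hC hA f i = A i (f i) :=
  rfl

/-- The direct sum of a pointwise bounded family of linear maps into operator spaces. -/
noncomputable def directSumMap {X : Type*} [AddCommGroup X] [Module ℂ X]
    (φ : ∀ i, X →ₗ[ℂ] (G i →L[ℂ] G i)) (C : X → ℝ) (hC : ∀ x, 0 ≤ C x)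
    (hφ : ∀ x i, ‖φ i x‖ ≤ C x) : X →ₗ[ℂ] (lp G 2 →L[ℂ] lp G 2) where
  toFun x := directSumOperator (fun i => φ i x) (C x) (hC x) (hφ x)
  map_add' x y := by ext f i; simp [directSumOperator_apply]
  map_smul' c x := by ext f i; simp [directSumOperator_apply]

variable {X : Type*} [AddCommGroup X] [Module ℂ X] (φ : ∀ i, X →ₗ[ℂ] (G i →L[ℂ] G i)) (C : X → ℝ)
  (hC : ∀ x, 0 ≤ C x) (hφ : ∀ x i, ‖φ i x‖ ≤ C x)

theorem directSumMap_apply (x : X) (f : lp G 2) (i : ι) :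
    directSumMap φ C hC hφ x f i = φ i x (f i) :=
  rfl

theorem hasSum_inner_matrixOperator_directSumMap {m : ℕ} (y : Matrix (Fin m) (Fin m) X)
    (ξ : PiLp 2 (fun _ : Fin m => lp G 2)) :
    HasSum (fun s => ⟪matrixOperator (y.map (φ s)) (WithLp.toLp 2 fun i => ξ i s),
      WithLp.toLp 2 fun i => ξ i s⟫_ℂ)
      ⟪matrixOperator (y.map (directSumMap φ C hC hφ)) ξ, ξ⟫_ℂ := by
  simp only [inner_matrixOperator]
  exact hasSum_sum fun i _ => hasSum_sum fun j _ => lp.hasSum_inner _ _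

/-- The form of the direct sum is the sum of the forms of the summands, and `‖ξ‖ ^ 2` splits over
the components in the same way. -/
theorem numericalRadius_directSumMap_le {m : ℕ} (y : Matrix (Fin m) (Fin m) X) {c : ℝ}
    (hc : 0 ≤ c) (h : ∀ i, numericalRadius (matrixOperator (y.map (φ i))) ≤ c) :
    numericalRadius (matrixOperator (y.map (directSumMap φ C hC hφ))) ≤ c := by
  refine numericalRadius_le _ _ hc fun ξ => ?_
  have hξ : HasSum (fun s => ‖(WithLp.toLp 2 fun i => ξ i s : PiLp 2 fun _ : Fin m => G s)‖ ^ 2)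
      (‖ξ‖ ^ 2) := by
    simp only [PiLp.norm_sq_eq_of_L2]
    exact hasSum_sum fun i _ => lp_hasSum_norm_sq (ξ i)
  rw [← (hasSum_inner_matrixOperator_directSumMap φ C hC hφ y ξ).tsum_eq]
  refine tsum_of_norm_bounded (hξ.mul_left c) fun s => ?_
  exact (norm_inner_le_numericalRadius _ _).trans
    (mul_le_mul_of_nonneg_right (h s) (sq_nonneg _))

/-- Vectors supported in the single summand `s` already realise its numerical radius. -/
theorem numericalRadius_le_directSumMap {m : ℕ} (y : Matrix (Fin m) (Fin m) X) (s : ι) :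
    numericalRadius (matrixOperator (y.map (φ s))) ≤
      numericalRadius (matrixOperator (y.map (directSumMap φ C hC hφ))) := by
  classical
  refine numericalRadius_le _ _ (numericalRadius_nonneg _) fun η => ?_
  let ξ : PiLp 2 (fun _ : Fin m => lp G 2) := WithLp.toLp 2 fun i => lp.single 2 s (η i)
  have h1 : ‖ξ‖ ^ 2 = ‖η‖ ^ 2 := by
    simp only [PiLp.norm_sq_eq_of_L2, ξ]
    exact Finset.sum_congr rfl fun i _ => by rw [lp.norm_single (by norm_num)]
  have h2 : ⟪matrixOperator (y.map (directSumMap φ C hC hφ)) ξ, ξ⟫_ℂ =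
      ⟪matrixOperator (y.map (φ s)) η, η⟫_ℂ := by
    simp only [inner_matrixOperator, ξ, lp.inner_single_right, Matrix.map_apply,
      directSumMap_apply, lp.single_apply_self]
  rw [← h1, ← h2]
  exact norm_inner_le_numericalRadius _ _

end DirectSumOfOperators

end

/-! ### Assembly of the representation. -/

theorem theorem2p1 {X : Type u} [AddCommGroup X] [Module ℂ X]
    (V : NumericalRadiusOperatorSpace X) :
    ∃ (H : Type u) (_ : NormedAddCommGroup H) (_ : InnerProductSpace ℂ H) (_ : CompleteSpace H)
      (Y : Submodule ℂ (H →L[ℂ] H)) (Φ : X →ₗ[ℂ] Y),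
      Function.Surjective Φ ∧
        IsWCompleteIsometry V (concreteNumericalRadiusOperatorSpace Y) Φ := by
  -- One summand for each matrix `x` of each size and each `ε = 1 / (k + 1)`. The index type lies in
  -- `Type u`, hence so does `H`.
  let ι := (Σ n : ℕ, Matrix (Fin n) (Fin n) X) × ℕ
  choose φ hle hge using fun s : ι =>
    V.exists_finiteDimensional_representation s.1.2 (Nat.one_div_pos_of_nat (α := ℝ) (n := s.2))
  have hφ : ∀ x s, ‖φ s x‖ ≤ 2 * V.W 2 !![0, x; 0, 0] := by
    intro x s
    refine (norm_le_two_mul_numericalRadius_offDiagonal _).trans ?_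
    have : !![0, φ s x; 0, 0] = (!![0, x; 0, 0] : Matrix (Fin 2) (Fin 2) X).map (φ s) := by
      ext i j : 2
      fin_cases i <;> fin_cases j <;> simp
    rw [this]
    exact mul_le_mul_of_nonneg_left (hle s 2 _) zero_le_two
  have hC : ∀ x, 0 ≤ 2 * V.W 2 !![0, x; 0, 0] := fun x =>
    mul_nonneg zero_le_two (apply_nonneg _ _)
  let Φ := directSumMap φ (fun x => 2 * V.W 2 !![0, x; 0, 0]) hC hφ
  refine ⟨lp (fun s : ι => EuclideanSpace ℂ (Fin s.1.1)) 2, inferInstance, inferInstance,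
    inferInstance, LinearMap.range Φ, Φ.rangeRestrict, Φ.surjective_rangeRestrict, fun n x => ?_⟩
  change numericalRadius (matrixOperator (x.map Φ)) = V.W n x
  refine le_antisymm
    (numericalRadius_directSumMap_le _ _ _ _ x (apply_nonneg _ _) fun s => hle s n x) ?_
  -- With `n` and `x` fixed, letting `k → ∞` removes the factor `1 + ε n`.
  have hlim : Filter.Tendsto
      (fun k : ℕ => numericalRadius (matrixOperator (x.map Φ)) * (1 + 1 / ((k : ℝ) + 1) * n))
      Filter.atTop (nhds (numericalRadius (matrixOperator (x.map Φ)) * (1 + 0 * n))) :=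
    ((tendsto_one_div_add_atTop_nhds_zero_nat.mul_const _).const_add 1).const_mul _
  rw [zero_mul, add_zero, mul_one] at hlim
  refine ge_of_tendsto' hlim fun k => (hge (⟨n, x⟩, k)).trans ?_
  exact mul_le_mul_of_nonneg_right (numericalRadius_le_directSumMap _ _ _ _ x _) (by positivity)
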